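/- Let $W$ and $V$ be finite-dimensional real vector spaces, let $G$ be a linear Lie group, that is, a closed subgroup of $\mathrm{Gl}(W)$, and let $$\mathfrak g=\{X\in\mathfrak{gl}(W)\;:\;\exp(tX)\in G\ \text{for all } t\in\mathbb R\}$$ be its Lie algebra, with the commutator bracket. Let $\rho:\mathfrak g\to\mathfrak{gl}(V)$ be a homomorphism of real Lie algebras, and for $u\in \mathrm{Gl}(V)$ let $\mathrm{Ad}_u\in\mathrm{Gl}(\mathfrak{gl}(V))$ be $A\mapsto uAu^{-1}$. Then every neighbourhood of $0$ in $\mathfrak g$ contains an open neighbourhood $\mathcal V$ of $0$ such that $\exp$ restricts to a homeomorphism, with smooth inverse, of $\mathcal V$ onto an open neighbourhood $\mathcal U$ of the identity in $G$, and such that the map $$R:\mathcal U\to \mathrm{Gl}(\mathfrak{gl}(V)),\qquad R(\exp X)=\mathrm{Ad}_{\exp\rho(X)}\quad (X\in\mathcal V),$$ is a local Lie group homomorphism: $R$ is smooth on $\mathcal U$, and $R(gh)=R(g)R(h)$ whenever $g$, $h$ and $gh$ lie in $\mathcal U$. On the same $\mathcal U$, the map $\mathcal U\to\mathrm{Gl}(V)$,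 $\exp X\mapsto\exp\rho(X)$, is a local Lie group homomorphism as well. (A map on a subset $\mathcal U$ of $G$ is called smooth if near every point of $\mathcal U$ it is the restriction of a $C^\infty$ map defined on an open subset of $\mathfrak{gl}(W)$.) -/

import Mathlib

open scoped Topology ContDiff

attribute [local instance 100] LieRing.ofAssociativeRing

noncomputable section

namespace LinearLie

section Exponential

variable {W : Type*} [NormedAddCommGroup W] [NormedSpace ℝ W] [FiniteDimensional ℝ W]

theorem exp_mul_exp_neg (X : W →L[ℝ] W) : NormedSpace.exp X * NormedSpace.exp (-X) = 1 := by
  have : CompleteSpace W := FiniteDimensional.complete ℝ W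
  let _ : NormedAlgebra ℚ (W →L[ℝ] W) := NormedAlgebra.restrictScalars ℚ ℝ (W →L[ℝ] W)
  rw [← NormedSpace.exp_add_of_commute (Commute.refl X).neg_right, add_neg_cancel,
    NormedSpace.exp_zero]

/-- The exponential map `exp : gl(W) → Gl(W)` of a finite-dimensional real vector space `W`.
All linear endomorphisms of `W` are continuous, so `gl(W)` is `W →L[ℝ] W` and `Gl(W)` is its
group of units. -/
def expGL (X : W →L[ℝ] W) : (W →L[ℝ] W)ˣ where
  val := NormedSpace.exp X
  inv := NormedSpace.exp (-X)
  val_inv := exp_mul_exp_neg X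
  inv_val := by simpa using exp_mul_exp_neg (-X)

@[simp] theorem val_expGL (X : W →L[ℝ] W) : (expGL X : W →L[ℝ] W) = NormedSpace.exp X := rfl

theorem isEmbedding_val : Topology.IsEmbedding (Units.val : (W →L[ℝ] W)ˣ → (W →L[ℝ] W)) := by
  have : CompleteSpace W := FiniteDimensional.complete ℝ W
  exact Units.isOpenEmbedding_val.isEmbedding

theorem continuous_exp : Continuous (NormedSpace.exp : (W →L[ℝ] W) → (W →L[ℝ] W)) := by
  have : CompleteSpace W := FiniteDimensional.complete ℝ W
  let _ : NormedAlgebra ℚ (W →L[ℝ] W) := NormedAlgebra.restrictScalars ℚ ℝ (W →L[ℝ] W)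
  exact NormedSpace.exp_continuous

theorem continuous_expGL : Continuous (expGL : (W →L[ℝ] W) → (W →L[ℝ] W)ˣ) :=
  isEmbedding_val.continuous_iff.2 continuous_exp

theorem expGL_zero : expGL (0 : W →L[ℝ] W) = 1 := by
  ext1; simp [NormedSpace.exp_zero]

theorem expGL_conj (u : (W →L[ℝ] W)ˣ) (X : W →L[ℝ] W) :
    expGL ((u : W →L[ℝ] W) * X * ((u⁻¹ : (W →L[ℝ] W)ˣ) : W →L[ℝ] W)) = u * expGL X * u⁻¹ := by
  have : CompleteSpace W := FiniteDimensional.complete ℝ W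
  let _ : NormedAlgebra ℚ (W →L[ℝ] W) := NormedAlgebra.restrictScalars ℚ ℝ (W →L[ℝ] W)
  apply Units.ext
  rw [val_expGL, NormedSpace.exp_units_conj, Units.val_mul, Units.val_mul, val_expGL]

theorem hasDerivAt_exp_smul_zero (X : W →L[ℝ] W) :
    HasDerivAt (fun t : ℝ => NormedSpace.exp (t • X)) X 0 := by
  have : CompleteSpace W := FiniteDimensional.complete ℝ W
  have h : HasFDerivAt (NormedSpace.exp : (W →L[ℝ] W) → (W →L[ℝ] W))
      (1 : (W →L[ℝ] W) →L[ℝ] (W →L[ℝ] W)) ((0 : ℝ) • X) := by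
    rw [zero_smul]; exact hasFDerivAt_exp_zero
  have h2 : HasDerivAt (fun t : ℝ => t • X) X 0 := by
    simpa using (hasDerivAt_id (0 : ℝ)).smul_const X
  have h3 := h.comp_hasDerivAt (0 : ℝ) h2
  exact h3

theorem norm_mul_pow_le {A B : W →L[ℝ] W} {r : ℝ} (hB : ‖B‖ ≤ r) (k : ℕ) :
    ‖A * B ^ k‖ ≤ ‖A‖ * r ^ k := by
  have hr : 0 ≤ r := (norm_nonneg _).trans hB
  induction k with
  | zero => simp
  | succ k ih =>
    calc ‖A * B ^ (k + 1)‖ = ‖A * B ^ k * B‖ := by rw [pow_succ, mul_assoc]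
      _ ≤ ‖A * B ^ k‖ * ‖B‖ := norm_mul_le _ _
      _ ≤ (‖A‖ * r ^ k) * r := by gcongr
      _ = ‖A‖ * r ^ (k + 1) := by ring

theorem norm_pow_sub_pow_le {A B : W →L[ℝ] W} {r : ℝ} (hr : 1 ≤ r) (hA : ‖A‖ ≤ r)
    (hB : ‖B‖ ≤ r) (k : ℕ) : ‖A ^ k - B ^ k‖ ≤ k * r ^ k * ‖A - B‖ := by
  induction k with
  | zero => simp
  | succ k ih =>
    have e : A ^ (k + 1) - B ^ (k + 1) = A * (A ^ k - B ^ k) + (A - B) * B ^ k := by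
      rw [pow_succ', pow_succ']; noncomm_ring
    have h1 : ‖A * (A ^ k - B ^ k)‖ ≤ r * (k * r ^ k * ‖A - B‖) :=
      (norm_mul_le _ _).trans (by gcongr)
    have h2 := norm_mul_pow_le (A := A - B) hB k
    have h3 : ‖A - B‖ * r ^ k ≤ ‖A - B‖ * r ^ (k + 1) := by
      exact mul_le_mul_of_nonneg_left (pow_le_pow_right₀ hr (Nat.le_succ k)) (norm_nonneg _)
    rw [e]
    refine (norm_add_le _ _).trans ?_
    push_cast
    rw [pow_succ] at h3 ⊢
    nlinarith

theorem tendsto_pow_exp {A : ℕ → (W →L[ℝ] W)} {Y : W →L[ℝ] W}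
    (hA : Filter.Tendsto (fun n : ℕ => (n : ℝ) • (A n - 1)) Filter.atTop (𝓝 Y)) :
    Filter.Tendsto (fun n : ℕ => A n ^ n) Filter.atTop (𝓝 (NormedSpace.exp Y)) := by
  have : CompleteSpace W := FiniteDimensional.complete ℝ W
  let _ : NormedAlgebra ℚ (W →L[ℝ] W) := NormedAlgebra.restrictScalars ℚ ℝ (W →L[ℝ] W)
  set B : ℕ → (W →L[ℝ] W) := fun n => NormedSpace.exp ((n : ℝ)⁻¹ • Y) with hBdef
  have hB : Filter.Tendsto (fun n : ℕ => (n : ℝ) • (B n - 1)) Filter.atTop (𝓝 Y) := by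
    have h := (hasDerivAt_exp_smul_zero Y).tendsto_slope_zero_right
    have h' := h.comp (tendsto_inv_atTop_nhdsGT_zero.comp
      (tendsto_natCast_atTop_atTop (R := ℝ)))
    simpa [Function.comp_def, NormedSpace.exp_zero] using h'
  have hBpow : ∀ᶠ n : ℕ in Filter.atTop, B n ^ n = NormedSpace.exp Y := by
    filter_upwards [Filter.eventually_gt_atTop 0] with n hn
    have hn' : (n : ℝ) ≠ 0 := by positivity
    rw [hBdef, ← NormedSpace.exp_nsmul, ← Nat.cast_smul_eq_nsmul ℝ, smul_smul,
      mul_inv_cancel₀ hn', one_smul]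
  have hone : ‖(1 : W →L[ℝ] W)‖ ≤ 1 := ContinuousLinearMap.norm_id_le
  have bound : ∀ {D : ℕ → (W →L[ℝ] W)},
      Filter.Tendsto (fun n : ℕ => (n : ℝ) • (D n - 1)) Filter.atTop (𝓝 Y) →
      ∀ᶠ n : ℕ in Filter.atTop, ‖D n‖ ≤ Real.exp ((‖Y‖ + 1) / n) := by
    intro D hD
    have h1 := hD.norm.eventually (gt_mem_nhds (lt_add_one ‖Y‖))
    filter_upwards [h1, Filter.eventually_gt_atTop 0] with n hn hn0
    have hn' : (0 : ℝ) < n := by positivity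
    rw [norm_smul, Real.norm_of_nonneg hn'.le] at hn
    have h2 : ‖D n - 1‖ ≤ (‖Y‖ + 1) / n := by
      rw [le_div_iff₀ hn']; linarith
    calc ‖D n‖ = ‖(D n - 1) + 1‖ := by rw [sub_add_cancel]
      _ ≤ ‖D n - 1‖ + ‖(1 : W →L[ℝ] W)‖ := norm_add_le _ _
      _ ≤ (‖Y‖ + 1) / n + 1 := add_le_add h2 hone
      _ ≤ _ := Real.add_one_le_exp _
  have hdiff : Filter.Tendsto (fun n : ℕ => Real.exp (‖Y‖ + 1) *
      ‖(n : ℝ) • (A n - 1) - (n : ℝ) • (B n - 1)‖) Filter.atTop (𝓝 0) := by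
    simpa using ((hA.sub hB).norm.const_mul (Real.exp (‖Y‖ + 1)))
  have hz : Filter.Tendsto (fun n : ℕ => A n ^ n - B n ^ n) Filter.atTop (𝓝 0) := by
    refine squeeze_zero_norm' ?_ hdiff
    filter_upwards [bound hA, bound hB, Filter.eventually_gt_atTop 0] with n h1 h2 hn0
    have hn' : (0 : ℝ) < n := by positivity
    have h3 := norm_pow_sub_pow_le (Real.one_le_exp (by positivity)) h1 h2 n
    have h4 : Real.exp ((‖Y‖ + 1) / n) ^ n = Real.exp (‖Y‖ + 1) := by
      rw [← Real.exp_nat_mul, mul_div_cancel₀ _ hn'.ne']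
    rw [h4] at h3
    have h5 : (n : ℝ) • (A n - 1) - (n : ℝ) • (B n - 1) = (n : ℝ) • (A n - B n) := by
      rw [← smul_sub, sub_sub_sub_cancel_right]
    rw [h5, norm_smul, Real.norm_of_nonneg hn'.le]
    linarith
  have := hz.add (tendsto_const_nhds (x := NormedSpace.exp Y))
  rw [zero_add] at this
  refine this.congr' ?_
  filter_upwards [hBpow] with n hn
  rw [hn, sub_add_cancel]

end Exponential

section LieAlgebra

variable {W : Type*} [NormedAddCommGroup W] [NormedSpace ℝ W] [FiniteDimensional ℝ W]

theorem expGL_mem_of_hasDerivAt (G : ClosedSubgroup (W →L[ℝ] W)ˣ) {γ : ℝ → (W →L[ℝ] W)ˣ}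
    {X : W →L[ℝ] W} (hγ : ∀ t, γ t ∈ G) (h0 : γ 0 = 1)
    (hd : HasDerivAt (fun t => (γ t : W →L[ℝ] W)) X 0) : expGL X ∈ G := by
  have h := hd.tendsto_slope_zero_right
  have h' := h.comp (tendsto_inv_atTop_nhdsGT_zero.comp
    (tendsto_natCast_atTop_atTop (R := ℝ)))
  have h2 := tendsto_pow_exp (A := fun n : ℕ => (γ (n : ℝ)⁻¹ : W →L[ℝ] W)) (Y := X)
    (by simpa [Function.comp_def, h0] using h')
  have h3 : Filter.Tendsto (fun n : ℕ => γ (n : ℝ)⁻¹ ^ n) Filter.atTop (𝓝 (expGL X)) :=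
    isEmbedding_val.tendsto_nhds_iff.2 (by simpa [Function.comp_def] using h2)
  exact G.isClosed'.mem_of_tendsto h3
    (Filter.Eventually.of_forall fun n => G.toSubgroup.pow_mem (hγ _) n)

theorem expGL_add_mem (G : ClosedSubgroup (W →L[ℝ] W)ˣ) {X Y : W →L[ℝ] W}
    (hX : ∀ t : ℝ, expGL (t • X) ∈ G) (hY : ∀ t : ℝ, expGL (t • Y) ∈ G) :
    expGL (X + Y) ∈ G := by
  refine expGL_mem_of_hasDerivAt G (γ := fun t => expGL (t • X) * expGL (t • Y))
    (fun t => G.toSubgroup.mul_mem (hX t) (hY t)) (by simp [expGL_zero]) ?_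
  have h := (hasDerivAt_exp_smul_zero X).mul (hasDerivAt_exp_smul_zero Y)
  simp only [zero_smul, NormedSpace.exp_zero, mul_one, one_mul] at h
  exact h

/-- The real vector space `{X ∈ gl(W) | exp (t X) ∈ G for all real t}`. -/
def lieSubmodule (G : ClosedSubgroup (W →L[ℝ] W)ˣ) : Submodule ℝ (W →L[ℝ] W) where
  carrier := {X | ∀ t : ℝ, expGL (t • X) ∈ G}
  add_mem' {X Y} hX hY t := by
    rw [smul_add]
    exact expGL_add_mem G (fun s => by rw [smul_smul]; exact hX _)
      (fun s => by rw [smul_smul]; exact hY _)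
  zero_mem' t := by
    rw [smul_zero, expGL_zero]; exact G.toSubgroup.one_mem
  smul_mem' c X hX t := by
    rw [smul_smul]; exact hX _

theorem isClosed_lieSubmodule (G : ClosedSubgroup (W →L[ℝ] W)ˣ) :
    IsClosed (lieSubmodule G : Set (W →L[ℝ] W)) := by
  have : (lieSubmodule G : Set (W →L[ℝ] W)) =
      ⋂ t : ℝ, (fun X => expGL (t • X)) ⁻¹' (G.toSubgroup : Set (W →L[ℝ] W)ˣ) := by
    ext X; simp [lieSubmodule]; rfl
  rw [this]
  exact isClosed_iInter fun t =>
    G.isClosed'.preimage (continuous_expGL.comp (continuous_const_smul t))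

theorem conj_mem (G : ClosedSubgroup (W →L[ℝ] W)ˣ) {u : (W →L[ℝ] W)ˣ} (hu : u ∈ G)
    {X : W →L[ℝ] W} (hX : X ∈ lieSubmodule G) :
    (u : W →L[ℝ] W) * X * ((u⁻¹ : (W →L[ℝ] W)ˣ) : W →L[ℝ] W) ∈ lieSubmodule G := by
  intro t
  have h := expGL_conj u (t • X)
  rw [mul_smul_comm, smul_mul_assoc] at h
  rw [h]
  exact G.toSubgroup.mul_mem (G.toSubgroup.mul_mem hu (hX t)) (G.toSubgroup.inv_mem hu)

theorem commutator_mem (G : ClosedSubgroup (W →L[ℝ] W)ˣ) {X Y : W →L[ℝ] W}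
    (hX : X ∈ lieSubmodule G) (hY : Y ∈ lieSubmodule G) :
    X * Y - Y * X ∈ lieSubmodule G := by
  have hneg : HasDerivAt (fun t : ℝ => NormedSpace.exp (-(t • X))) (-X) 0 := by
    simpa using hasDerivAt_exp_smul_zero (-X)
  have hd : HasDerivAt (fun t : ℝ => NormedSpace.exp (t • X) * Y * NormedSpace.exp (-(t • X)))
      (X * Y - Y * X) 0 := by
    have h := ((hasDerivAt_exp_smul_zero X).mul_const Y).mul hneg
    simp only [zero_smul, neg_zero, NormedSpace.exp_zero, mul_one, one_mul, mul_neg,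
      ← sub_eq_add_neg] at h
    exact h
  refine (isClosed_lieSubmodule G).mem_of_tendsto hd.tendsto_slope_zero_right
    (Filter.Eventually.of_forall fun t => ?_)
  refine (lieSubmodule G).smul_mem _ ((lieSubmodule G).sub_mem ?_ ?_)
  · exact conj_mem G (hX (0 + t)) hY
  · simpa [NormedSpace.exp_zero] using hY

/-- The linear Lie algebra `𝔤 = {X ∈ gl(W) | exp (t X) ∈ G for all real t}` of a linear Lie group
`G`, that is, of a closed subgroup `G` of `Gl(W)`; its bracket is the commutator. -/
def lieAlgebra (G : ClosedSubgroup (W →L[ℝ] W)ˣ) : LieSubalgebra ℝ (W →L[ℝ] W) where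
  toSubmodule := lieSubmodule G
  lie_mem' {X Y} hX hY := by
    rw [Ring.lie_def]; exact commutator_mem G hX hY

theorem mem_lieAlgebra {G : ClosedSubgroup (W →L[ℝ] W)ˣ} {X : W →L[ℝ] W} :
    X ∈ lieAlgebra G ↔ ∀ t : ℝ, expGL (t • X) ∈ G := Iff.rfl

/-- The exponential map `exp : 𝔤 → G` of a linear Lie group. -/
def exp {G : ClosedSubgroup (W →L[ℝ] W)ˣ} (X : lieAlgebra G) : G.toSubgroup :=
  ⟨expGL (X : W →L[ℝ] W), by
    have h := mem_lieAlgebra.1 X.2 1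
    rw [one_smul] at h
    exact h⟩

end LieAlgebra

section Adjoint

variable {V : Type*} [NormedAddCommGroup V] [NormedSpace ℝ V]

/-- The linear map `A ↦ u A u⁻¹` of `gl(V)`. -/
def conjL (u : (V →L[ℝ] V)ˣ) : (V →L[ℝ] V) →L[ℝ] (V →L[ℝ] V) :=
  (ContinuousLinearMap.mul ℝ (V →L[ℝ] V) (u : V →L[ℝ] V)).comp
    ((ContinuousLinearMap.mul ℝ (V →L[ℝ] V)).flip ((u⁻¹ : (V →L[ℝ] V)ˣ) : V →L[ℝ] V))

theorem conjL_apply (u : (V →L[ℝ] V)ˣ) (A : V →L[ℝ] V) :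
    conjL u A = (u : V →L[ℝ] V) * A * ((u⁻¹ : (V →L[ℝ] V)ˣ) : V →L[ℝ] V) := by
  simp [conjL, mul_assoc]

theorem conjL_mul (u v : (V →L[ℝ] V)ˣ) : conjL u * conjL v = conjL (u * v) := by
  refine ContinuousLinearMap.ext fun A => ?_
  rw [mul_apply_eq_comp]
  simp only [conjL_apply, mul_inv_rev, Units.val_mul, mul_assoc]

theorem conjL_one : conjL (1 : (V →L[ℝ] V)ˣ) = 1 := by
  refine ContinuousLinearMap.ext fun A => ?_
  simp [conjL_apply]

/-- The adjoint representation `Ad : Gl(V) → Gl(gl(V))`, `Ad_u A = u A u⁻¹`. -/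
def Ad (u : (V →L[ℝ] V)ˣ) : ((V →L[ℝ] V) →L[ℝ] (V →L[ℝ] V))ˣ where
  val := conjL u
  inv := conjL u⁻¹
  val_inv := by rw [conjL_mul, mul_inv_cancel, conjL_one]
  inv_val := by rw [conjL_mul, inv_mul_cancel, conjL_one]

theorem Ad_apply (u : (V →L[ℝ] V)ˣ) (A : V →L[ℝ] V) :
    (Ad u : (V →L[ℝ] V) →L[ℝ] (V →L[ℝ] V)) A =
      (u : V →L[ℝ] V) * A * ((u⁻¹ : (V →L[ℝ] V)ˣ) : V →L[ℝ] V) :=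
  conjL_apply u A

end Adjoint

section LocalHomomorphism

variable {W : Type*} [NormedAddCommGroup W] [NormedSpace ℝ W]
variable {E : Type*} [NormedAddCommGroup E] [NormedSpace ℝ E]

/-- Smoothness on a subset `U` of a linear Lie group `G ⊆ Gl(W)` of a map with values in a
normed space: near every point of `U` the map is the restriction of a `C^∞` map defined on an
open subset of the ambient space `gl(W)`. -/
def SmoothOn {G : ClosedSubgroup (W →L[ℝ] W)ˣ} (U : Set G.toSubgroup)
    (f : G.toSubgroup → E) : Prop :=
  ∀ g ∈ U, ∃ (N : Set (W →L[ℝ] W)) (F : (W →L[ℝ] W) → E),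
    IsOpen N ∧ ((g : (W →L[ℝ] W)ˣ) : W →L[ℝ] W) ∈ N ∧ ContDiffOn ℝ ∞ F N ∧
      ∀ h ∈ U, ((h : (W →L[ℝ] W)ˣ) : W →L[ℝ] W) ∈ N →
        F ((h : (W →L[ℝ] W)ˣ) : W →L[ℝ] W) = f h

/-- `R` is, on `U`, a local Lie group homomorphism from `G` to `Gl(E)`: `U` is an open
neighbourhood of the identity, `R` is smooth on `U` (as a map into the open subset `Gl(E)` of
`gl(E)`), and `R (g h) = R g R h` whenever `g`, `h` and `g h` lie in `U`. -/
structure IsLocalLieGroupHom {G : ClosedSubgroup (W →L[ℝ] W)ˣ} (U : Set G.toSubgroup)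
    (R : G.toSubgroup → (E →L[ℝ] E)ˣ) : Prop where
  isOpen : IsOpen U
  one_mem : 1 ∈ U
  smoothOn : SmoothOn U fun g => (R g : E →L[ℝ] E)
  map_mul : ∀ g ∈ U, ∀ h ∈ U, g * h ∈ U → R (g * h) = R g * R h

end LocalHomomorphism

end LinearLie

end

/-! Near the identity `exp` has a smooth inverse `log`, so both maps are determined: `S g = exp (ρ
(log g))` and `R = Ad ∘ S`. Their smoothness is that of `log`, which is the closed subgroup theorem
(`exists_openPartialHomeomorph_exp`). Since `Ad` is multiplicative, all that is left is `S (g h) = S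
g * S h`.

This is proved with a differential equation in place of the Baker–Campbell–Hausdorff series. Let `g
= exp x`, `h = exp y` and `Z t = log (exp x * exp (t y))`. In any representation `ψ` of the Lie
algebra, the left logarithmic derivative of `exp (ψ (Z t))` is `ψ` of the vector `leftDexp ad (Z t)
(Z' t)` (`hasDerivAt_exp_comp`). That vector depends on the bracket alone. The inclusion into
`gl(W)` is a faithful representation and gives the curve `exp x * exp (t y)`, so the vector is
constantly `y`. Hence `exp (ρ (Z t))` has constant left logarithmic derivative `ρ y` and equals `exp
(ρ x) * exp (t ρ y)` (`exp_map_eq_of_hasDerivAt`); `t = 1` is the claim. The domain is shrunk in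
`exists_local_hom` so that `Z` is defined on all of `[0, 1]`. -/

namespace LinearLie

/-! ### The bracket in linear coordinates -/

section Coordinates

variable {A : Type*} [NormedRing A] [NormedAlgebra ℝ A]
variable {L : Type*} [NormedAddCommGroup L] [NormedSpace ℝ L]

/-- The commutator bracket of `A`, transported to `L` along `ι` and `p`. -/
noncomputable def coordBracket (ι : L →L[ℝ] A) (p : A →L[ℝ] L) : L →L[ℝ] L →L[ℝ] L :=
  (ContinuousLinearMap.compL ℝ L A L p).comp
    ((ContinuousLinearMap.mul ℝ A - (ContinuousLinearMap.mul ℝ A).flip).bilinearComp ι ι)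

end Coordinates

/-! ### The derivative of the exponential map -/

section BanachAlgebra

variable {A : Type*} [NormedRing A] [NormedAlgebra ℝ A] [CompleteSpace A]

theorem contDiff_exp {n : WithTop ℕ∞} : ContDiff ℝ n (NormedSpace.exp : A → A) :=
  AnalyticOnNhd.contDiff fun x _ => NormedSpace.exp_analytic x

theorem exp_neg_mul_exp (x : A) : NormedSpace.exp (-x) * NormedSpace.exp x = 1 := by
  let _ : NormedAlgebra ℚ A := NormedAlgebra.restrictScalars ℚ ℝ A
  rw [← NormedSpace.exp_add_of_commute (Commute.refl x).neg_left, neg_add_cancel,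
    NormedSpace.exp_zero]

theorem continuous_exp_smul (x : A) : Continuous fun s : ℝ => NormedSpace.exp (s • x) :=
  (contDiff_exp (n := 0)).continuous.comp (continuous_id.smul continuous_const)

theorem hasDerivAt_exp_neg_smul_mul_mul_exp_smul (x y c : A) (s : ℝ) :
    HasDerivAt (fun t : ℝ => NormedSpace.exp (-(t • x)) * c * NormedSpace.exp (t • y))
      (NormedSpace.exp (-(s • x)) * (c * y - x * c) * NormedSpace.exp (s • y)) s := by
  have h1 : HasDerivAt (fun t : ℝ => NormedSpace.exp (-(t • x)))
      (NormedSpace.exp (-(s • x)) * -x) s := by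
    simpa using hasDerivAt_exp_smul_const (𝕂 := ℝ) (-x) s
  refine ((h1.mul_const c).mul (hasDerivAt_exp_smul_const' (𝕂 := ℝ) y s)).congr_deriv ?_
  noncomm_ring

/-- Duhamel's formula. -/
theorem exp_neg_mul_exp_sub_one (x y : A) :
    NormedSpace.exp (-x) * NormedSpace.exp y - 1 =
      ∫ s in (0 : ℝ)..1,
        NormedSpace.exp (-(s • x)) * (y - x) * NormedSpace.exp (s • y) := by
  -- With `c = 1` the middle factor `c * y - x * c` is `y - x`.
  have h := intervalIntegral.integral_eq_sub_of_hasDerivAt (a := (0 : ℝ)) (b := 1)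
    (fun s _ => hasDerivAt_exp_neg_smul_mul_mul_exp_smul x y 1 s) ?_
  · simpa [NormedSpace.exp_zero] using h.symm
  · refine Continuous.intervalIntegrable ?_ _ _
    have h1 := continuous_exp_smul (-x)
    simp only [smul_neg] at h1
    exact (h1.mul continuous_const).mul (continuous_exp_smul y)

/-- The derivative of the exponential map of a Banach algebra. -/
theorem fderiv_exp_apply (x h : A) :
    fderiv ℝ (NormedSpace.exp : A → A) x h = NormedSpace.exp x *
      ∫ s in (0 : ℝ)..1, NormedSpace.exp (-(s • x)) * h * NormedSpace.exp (s • x) := by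
  have hd : HasFDerivAt (NormedSpace.exp : A → A) (fderiv ℝ NormedSpace.exp x)
      (x + (0 : ℝ) • h) := by
    rw [zero_smul, add_zero]
    exact ((contDiff_exp (n := 1)).differentiable one_ne_zero x).hasFDerivAt
  have hl : HasDerivAt (fun t : ℝ => x + t • h) h 0 := by
    simpa using ((hasDerivAt_id (0 : ℝ)).smul_const h).const_add x
  -- The difference quotient of `exp (-x) * exp (x + t h)` at `t = 0` is computed in two ways: its
  -- limit is `exp (-x)` times the derivative, and by Duhamel it equals, for `t ≠ 0`, an integral
  -- that is continuous in `t`.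
  have h1 := ((hd.comp_hasDerivAt (0 : ℝ) hl).const_mul
    (NormedSpace.exp (-x))).tendsto_slope_zero
  have hc : Continuous fun t : ℝ => ∫ s in (0 : ℝ)..1,
      NormedSpace.exp (-(s • x)) * h * NormedSpace.exp (s • (x + t • h)) := by
    refine intervalIntegral.continuous_parametric_intervalIntegral_of_continuous' ?_ 0 1
    have he : Continuous (NormedSpace.exp : A → A) := (contDiff_exp (n := 0)).continuous
    simp only [Function.uncurry_def]
    fun_prop
  have h2 := (hc.tendsto 0).mono_left (nhdsWithin_le_nhds (s := {0}ᶜ))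
  have h3 := tendsto_nhds_unique_of_eventuallyEq h1 h2 ?_
  · simp only [zero_smul, add_zero] at h3
    -- The double negation brings `exp x * exp (-x)` into the form of `exp_neg_mul_exp`.
    rw [← h3, ← mul_assoc, ← neg_neg x, neg_neg (-x), exp_neg_mul_exp, one_mul]
  · filter_upwards [self_mem_nhdsWithin] with t ht
    simp only [zero_add, Function.comp_apply, zero_smul, add_zero, exp_neg_mul_exp,
      exp_neg_mul_exp_sub_one, add_sub_cancel_left]
    rw [← intervalIntegral.integral_smul]
    congr 1
    ext s
    rw [mul_smul_comm, smul_mul_assoc, smul_smul, inv_mul_cancel₀ ht, one_smul]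

/-- The two factors contribute `q` and `id - q`, whatever `q` is. -/
theorem hasFDerivAt_exp_mul_exp_sub (q : A →L[ℝ] A) :
    HasFDerivAt (fun a => NormedSpace.exp (q a) * NormedSpace.exp (a - q a))
      (ContinuousLinearMap.id ℝ A) 0 := by
  have he : ∀ q : A →L[ℝ] A, HasFDerivAt (fun a => NormedSpace.exp (q a)) q 0 := by
    intro q
    have h : HasFDerivAt (NormedSpace.exp : A → A) (1 : A →L[ℝ] A) (q 0) := by
      rw [map_zero]; exact hasFDerivAt_exp_zero
    exact h.comp 0 q.hasFDerivAt
  refine ((he q).mul' (he (ContinuousLinearMap.id ℝ A - q))).congr_fderiv ?_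
  ext1 a
  simp [NormedSpace.exp_zero]

/-- This is `conjL (expGL a)` unfolded; since the inverse is `exp (-a)`, smoothness of inversion is
not needed. -/
theorem contDiff_exp_conj {n : WithTop ℕ∞} :
    ContDiff ℝ n fun a : A => (ContinuousLinearMap.mul ℝ A (NormedSpace.exp a)).comp
      ((ContinuousLinearMap.mul ℝ A).flip (NormedSpace.exp (-a))) := by
  have h1 : ContDiff ℝ n fun a : A => ContinuousLinearMap.mul ℝ A (NormedSpace.exp a) :=
    (ContinuousLinearMap.mul ℝ A).contDiff.comp contDiff_exp
  have h2 : ContDiff ℝ n fun a : A => (ContinuousLinearMap.mul ℝ A).flip (NormedSpace.exp (-a)) :=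
    (ContinuousLinearMap.mul ℝ A).flip.contDiff.comp (contDiff_exp.comp contDiff_neg)
  exact h1.clm_comp h2

/-! ### Transfer of logarithmic derivatives between representations -/

variable {L : Type*} [NormedAddCommGroup L] [NormedSpace ℝ L] [FiniteDimensional ℝ L]

/-- A linear map intertwining `ad` with the commutator intertwines `exp (-s ad x)` with
conjugation by `exp (-s ψ x)`. -/
theorem map_exp_neg_smul_ad (ad : L →L[ℝ] L →L[ℝ] L) (ψ : L →L[ℝ] A)
    (hψ : ∀ x y, ψ (ad x y) = ψ x * ψ y - ψ y * ψ x) (x y : L) (s : ℝ) :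
    ψ (NormedSpace.exp (s • -ad x) y) =
      NormedSpace.exp (-(s • ψ x)) * ψ y * NormedSpace.exp (s • ψ x) := by
  have : CompleteSpace L := FiniteDimensional.complete ℝ L
  -- Undoing the conjugation gives a curve whose derivative vanishes by `hψ`, so it stays at `c 0 =
  -- ψ y`.
  set c : ℝ → A := fun t => NormedSpace.exp (t • ψ x) * ψ (NormedSpace.exp (t • -ad x) y) *
    NormedSpace.exp (-(t • ψ x)) with hcdef
  have hc : ∀ t, HasDerivAt c 0 t := by
    intro t
    have h1 : HasDerivAt (fun t : ℝ => NormedSpace.exp (-(t • ψ x)))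
        (-ψ x * NormedSpace.exp (-(t • ψ x))) t := by
      simpa using hasDerivAt_exp_smul_const' (𝕂 := ℝ) (-ψ x) t
    have h2 : HasDerivAt (fun t : ℝ => ψ (NormedSpace.exp (t • -ad x) y))
        (ψ ((-ad x * NormedSpace.exp (t • -ad x)) y)) t :=
      ψ.hasFDerivAt.comp_hasDerivAt t
        ((hasDerivAt_exp_smul_const' (𝕂 := ℝ) (-ad x) t).clm_apply
          (hasDerivAt_const t y) |>.congr_deriv (by simp))
    refine (((hasDerivAt_exp_smul_const (𝕂 := ℝ) (ψ x) t).mul h2).mul h1).congr_deriv ?_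
    simp only [Pi.mul_apply, mul_apply_eq_comp, neg_apply, map_neg, hψ]
    generalize ψ (NormedSpace.exp (t • -ad x) y) = w
    noncomm_ring
  have h := is_const_of_deriv_eq_zero (fun t => (hc t).differentiableAt)
    (fun t => (hc t).deriv) s 0
  have h0 : c 0 = ψ y := by simp [hcdef, NormedSpace.exp_zero]
  rw [h0] at h
  have e1 := exp_neg_mul_exp (s • ψ x)
  rw [← h, hcdef]
  simp only [← mul_assoc, e1, one_mul]
  rw [mul_assoc, e1, mul_one]

/-- The left-trivialised derivative of the exponential map, `(1 - exp (-ad x)) / ad x`. -/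
noncomputable def leftDexp (ad : L →L[ℝ] L →L[ℝ] L) (x y : L) : L :=
  ∫ s in (0 : ℝ)..1, NormedSpace.exp (s • -ad x) y

/-- Under the integral for the derivative of `exp`, conjugation by `exp (-s ψ x)` becomes `exp (-s
ad x)` inside `ψ`, and `ψ` then leaves the integral. What remains under `ψ` no longer depends on the
representation. -/
theorem hasDerivAt_exp_comp (ad : L →L[ℝ] L →L[ℝ] L) (ψ : L →L[ℝ] A)
    (hψ : ∀ x y, ψ (ad x y) = ψ x * ψ y - ψ y * ψ x) {Z : ℝ → L} {Z' : L} {t : ℝ}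
    (hZ : HasDerivAt Z Z' t) :
    HasDerivAt (fun t => NormedSpace.exp (ψ (Z t)))
      (NormedSpace.exp (ψ (Z t)) * ψ (leftDexp ad (Z t) Z')) t := by
  have : CompleteSpace L := FiniteDimensional.complete ℝ L
  have hd := ((contDiff_exp (A := A) (n := 1)).differentiable one_ne_zero (ψ (Z t))).hasFDerivAt
  refine (hd.comp_hasDerivAt t (ψ.hasFDerivAt.comp_hasDerivAt t hZ)).congr_deriv ?_
  rw [fderiv_exp_apply, leftDexp, ← ψ.intervalIntegral_comp_comm]
  · simp only [map_exp_neg_smul_ad ad ψ hψ]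
  · exact ((continuous_exp_smul (-ad (Z t))).clm_apply continuous_const).intervalIntegrable _ _

/-- A curve `Z` whose exponential has constant left logarithmic derivative `y` under a faithful
representation has the same property under every other representation. -/
theorem exp_map_eq_of_hasDerivAt {B : Type*} [NormedRing B] [NormedAlgebra ℝ B] [CompleteSpace B]
    (ad : L →L[ℝ] L →L[ℝ] L) (φ : L →L[ℝ] A) (ψ : L →L[ℝ] B)
    (hφ : ∀ x y, φ (ad x y) = φ x * φ y - φ y * φ x)
    (hψ : ∀ x y, ψ (ad x y) = ψ x * ψ y - ψ y * ψ x)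
    (hinj : Function.Injective φ) {Z : ℝ → L} {y : L}
    (hZ : ∀ t ∈ Set.Icc (0 : ℝ) 1, DifferentiableAt ℝ Z t)
    (hexp : ∀ t ∈ Set.Icc (0 : ℝ) 1,
      (fun t => NormedSpace.exp (φ (Z t))) =ᶠ[𝓝 t]
        fun t => NormedSpace.exp (φ (Z 0)) * NormedSpace.exp (t • φ y)) :
    NormedSpace.exp (ψ (Z 1)) = NormedSpace.exp (ψ (Z 0)) * NormedSpace.exp (ψ y) := by
  -- The two expressions for the derivative of `exp (φ (Z t))` agree; after cancelling the
  -- exponential, faithfulness of `φ` gives an identity in `L` itself.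
  have key : ∀ t ∈ Set.Icc (0 : ℝ) 1, leftDexp ad (Z t) (deriv Z t) = y := by
    intro t ht
    have h1 := hasDerivAt_exp_comp ad φ hφ (hZ t ht).hasDerivAt
    have h2 := ((hasDerivAt_exp_smul_const (𝕂 := ℝ) (φ y) t).const_mul
      (NormedSpace.exp (φ (Z 0)))).congr_of_eventuallyEq (hexp t ht)
    have h3 := h1.unique h2
    rw [← mul_assoc, ← (hexp t ht).eq_of_nhds] at h3
    have h4 := congrArg (fun a => NormedSpace.exp (-φ (Z t)) * a) h3
    simp only [← mul_assoc, exp_neg_mul_exp, one_mul] at h4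
    exact hinj h4
  -- By `key`, `exp (ψ (Z t))` has left logarithmic derivative `ψ y`, so `f` is constant on `[0,
  -- 1]`.
  set f : ℝ → B := fun t => NormedSpace.exp (ψ (Z t)) * NormedSpace.exp (-(t • ψ y)) with hf
  have hd : ∀ t ∈ Set.Icc (0 : ℝ) 1, HasDerivAt f 0 t := by
    intro t ht
    have h1 : HasDerivAt (fun t : ℝ => NormedSpace.exp (-(t • ψ y)))
        (-ψ y * NormedSpace.exp (-(t • ψ y))) t := by
      simpa using hasDerivAt_exp_smul_const' (𝕂 := ℝ) (-ψ y) t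
    refine ((hasDerivAt_exp_comp ad ψ hψ (hZ t ht).hasDerivAt).mul h1).congr_deriv ?_
    rw [key t ht]
    noncomm_ring
  have h := constant_of_has_deriv_right_zero (a := (0 : ℝ)) (b := 1)
    (fun t ht => (hd t ht).continuousAt.continuousWithinAt)
    (fun t ht => (hd t (Set.Ico_subset_Icc_self ht)).hasDerivWithinAt) 1 (by simp)
  simp only [hf, one_smul, zero_smul, neg_zero, NormedSpace.exp_zero, mul_one] at h
  rw [← h, mul_assoc, exp_neg_mul_exp, mul_one]

end BanachAlgebra

/-! ### The closed subgroup theorem -/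

section ClosedSubgroup

open Filter

variable {W : Type*} [NormedAddCommGroup W] [NormedSpace ℝ W] [FiniteDimensional ℝ W]

theorem expGL_neg (X : W →L[ℝ] W) : expGL (-X) = (expGL X)⁻¹ := Units.ext rfl

theorem expGL_nsmul (n : ℕ) (X : W →L[ℝ] W) : expGL (n • X) = expGL X ^ n := by
  have : CompleteSpace W := FiniteDimensional.complete ℝ W
  let _ : NormedAlgebra ℚ (W →L[ℝ] W) := NormedAlgebra.restrictScalars ℚ ℝ (W →L[ℝ] W)
  apply Units.ext
  rw [val_expGL, NormedSpace.exp_nsmul, Units.val_pow_eq_pow_val, val_expGL]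

/-- A limit of directions of logarithms of elements of `G` tending to `1` lies in `𝔤`. -/
theorem mem_lieSubmodule_of_tendsto (G : ClosedSubgroup (W →L[ℝ] W)ˣ) {M : ℕ → (W →L[ℝ] W)}
    {X : W →L[ℝ] W} (hM0 : ∀ n, M n ≠ 0) (hM : Tendsto M atTop (𝓝 0))
    (hG : ∀ n, expGL (M n) ∈ G) (hX : Tendsto (fun n => ‖M n‖⁻¹ • M n) atTop (𝓝 X)) :
    X ∈ lieSubmodule G := by
  have hnonneg : ∀ t : ℝ, 0 ≤ t → expGL (t • X) ∈ G := by
    intro t ht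
    have hx : Tendsto (fun n => ‖M n‖⁻¹) atTop atTop := by
      refine tendsto_inv_nhdsGT_zero.comp (tendsto_nhdsWithin_iff.2 ⟨by simpa using hM.norm, ?_⟩)
      exact Eventually.of_forall fun n => norm_pos_iff.2 (hM0 n)
    -- With `k = ⌊t / ‖M n‖⌋` one has `k ‖M n‖ → t`, so `k • M n → t • X`, while `exp (k • M n) =
    -- exp (M n) ^ k` lies in the closed group `G`.
    have h1 := ((tendsto_nat_floor_mul_div_atTop ht).comp hx).smul hX
    refine G.isClosed'.mem_of_tendsto ((continuous_expGL.tendsto _).comp h1)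
      (Eventually.of_forall fun n => ?_)
    have h2 : ((⌊t * ‖M n‖⁻¹⌋₊ : ℝ) / ‖M n‖⁻¹) • ‖M n‖⁻¹ • M n = ⌊t * ‖M n‖⁻¹⌋₊ • M n := by
      rw [smul_smul, div_mul_cancel₀ _ (inv_ne_zero (norm_ne_zero_iff.2 (hM0 n))),
        Nat.cast_smul_eq_nsmul]
    simp only [Function.comp_apply]
    rw [h2, expGL_nsmul]
    exact G.toSubgroup.pow_mem (hG n) _
  intro t
  rcases le_total 0 t with ht | ht
  · exact hnonneg t ht
  · have h := G.toSubgroup.inv_mem (hnonneg (-t) (neg_nonneg.2 ht))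
    rwa [← expGL_neg, neg_smul, neg_neg] at h

/-- In a complement of the Lie algebra of `G`, only `0` exponentiates into `G` near `0`. -/
theorem eventually_eq_zero_of_expGL_mem (G : ClosedSubgroup (W →L[ℝ] W)ˣ)
    {K : Submodule ℝ (W →L[ℝ] W)} (hK : Disjoint (lieSubmodule G) K) :
    ∀ᶠ M in 𝓝 (0 : W →L[ℝ] W), M ∈ K → expGL M ∈ G → M = 0 := by
  by_contra hcon
  obtain ⟨M, hM, hP⟩ := exists_seq_forall_of_frequently (not_eventually.1 hcon)
  simp only [Classical.not_imp] at hP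
  have hs : ∀ n, ‖M n‖⁻¹ • M n ∈ Metric.sphere (0 : W →L[ℝ] W) 1 := fun n => by
    rw [mem_sphere_zero_iff_norm, norm_smul, norm_inv, norm_norm,
      inv_mul_cancel₀ (norm_ne_zero_iff.2 (hP n).2.2)]
  -- Counterexamples tending to `0`, normalised, accumulate by compactness at a unit vector, which
  -- lies both in the Lie algebra and in `K`.
  have : ProperSpace (W →L[ℝ] W) := FiniteDimensional.proper_real _
  obtain ⟨X, hXs, φ, hφ, hX⟩ := (isCompact_sphere (0 : W →L[ℝ] W) 1).tendsto_subseq hs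
  have hXG : X ∈ lieSubmodule G := mem_lieSubmodule_of_tendsto G (fun n => (hP (φ n)).2.2)
    (hM.comp hφ.tendsto_atTop) (fun n => (hP (φ n)).2.1) hX
  have hXK : X ∈ K := K.closed_of_finiteDimensional.mem_of_tendsto hX
    (Eventually.of_forall fun n => K.smul_mem _ (hP (φ n)).1)
  have h0 : X = 0 := (Submodule.disjoint_def.1 hK) X hXG hXK
  rw [h0, mem_sphere_zero_iff_norm, norm_zero] at hXs
  exact zero_ne_one hXs

/-- Linear coordinates on the Lie algebra of `G`, extended to `gl(W)`. -/
theorem exists_coordinates (G : ClosedSubgroup (W →L[ℝ] W)ˣ) :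
    ∃ (n : ℕ) (ι : (Fin n → ℝ) →L[ℝ] (W →L[ℝ] W)) (p : (W →L[ℝ] W) →L[ℝ] (Fin n → ℝ)),
      (∀ x, p (ι x) = x) ∧ (∀ x, ι x ∈ lieSubmodule G) ∧
        ∀ X ∈ lieSubmodule G, ι (p X) = X := by
  obtain ⟨q, hq⟩ := LinearMap.exists_leftInverse_of_injective
    (lieSubmodule G).subtype (Submodule.ker_subtype _)
  set f := (Module.finBasis ℝ (lieSubmodule G)).equivFun with hf
  have hq' : ∀ X : lieSubmodule G, q (X : W →L[ℝ] W) = X := LinearMap.congr_fun hq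
  refine ⟨_, LinearMap.toContinuousLinearMap ((lieSubmodule G).subtype ∘ₗ f.symm.toLinearMap),
    LinearMap.toContinuousLinearMap (f.toLinearMap ∘ₗ q), fun x => ?_, fun x => ?_,
    fun X hX => ?_⟩
  · change f (q ((f.symm x : lieSubmodule G) : W →L[ℝ] W)) = x
    rw [hq', f.apply_symm_apply]
  · exact (f.symm x).2
  · change ((f.symm (f (q X)) : lieSubmodule G) : W →L[ℝ] W) = X
    rw [f.symm_apply_apply]
    exact congrArg Subtype.val (hq' ⟨X, hX⟩)

variable {L : Type*} [NormedAddCommGroup L] [NormedSpace ℝ L]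

/-- The product of the exponentials of `ι (p A)` and `A - ι (p A)`. -/
noncomputable def expProd (ι : L →L[ℝ] (W →L[ℝ] W)) (p : (W →L[ℝ] W) →L[ℝ] L) (A : W →L[ℝ] W) :
    W →L[ℝ] W :=
  NormedSpace.exp (ι (p A)) * NormedSpace.exp (A - ι (p A))

theorem contDiff_expProd (ι : L →L[ℝ] (W →L[ℝ] W)) (p : (W →L[ℝ] W) →L[ℝ] L)
    {n : WithTop ℕ∞} : ContDiff ℝ n (expProd ι p) := by
  have : CompleteSpace W := FiniteDimensional.complete ℝ W
  have h : ContDiff ℝ n fun A => ι (p A) := (ι.comp p).contDiff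
  exact (contDiff_exp.comp h).mul (contDiff_exp.comp (contDiff_id.sub h))

/-- The identity is written as an equivalence because the inverse function theorem asks for one. -/
theorem hasFDerivAt_expProd (ι : L →L[ℝ] (W →L[ℝ] W)) (p : (W →L[ℝ] W) →L[ℝ] L) :
    HasFDerivAt (expProd ι p)
      ((ContinuousLinearEquiv.refl ℝ (W →L[ℝ] W) : (W →L[ℝ] W) →L[ℝ] (W →L[ℝ] W))) 0 := by
  have : CompleteSpace W := FiniteDimensional.complete ℝ W
  exact hasFDerivAt_exp_mul_exp_sub (ι.comp p)

/-- The closed subgroup theorem: `exp` is a local homeomorphism from `𝔤` to `G` at `0`, and its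
local inverse extends, in linear coordinates, to a smooth map on an open subset of `gl(W)`. -/
theorem exists_openPartialHomeomorph_exp (G : ClosedSubgroup (W →L[ℝ] W)ˣ)
    (ι : L →L[ℝ] (W →L[ℝ] W)) (p : (W →L[ℝ] W) →L[ℝ] L) (hp : ∀ x, p (ι x) = x)
    (hι : ∀ x, ι x ∈ lieSubmodule G) (hιp : ∀ X ∈ lieSubmodule G, ι (p X) = X) :
    ∃ (e : OpenPartialHomeomorph (lieAlgebra G) G.toSubgroup) (O : Set (W →L[ℝ] W))
      (F : (W →L[ℝ] W) → L), 0 ∈ e.source ∧ (∀ X ∈ e.source, e X = exp X) ∧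
      IsOpen O ∧ ContDiffOn ℝ ∞ F O ∧
      ∀ g : G.toSubgroup, g ∈ e.target → ((g : (W →L[ℝ] W)ˣ) : W →L[ℝ] W) ∈ O ∧
        ι (F ((g : (W →L[ℝ] W)ˣ) : W →L[ℝ] W)) = e.symm g := by
  have : CompleteSpace W := FiniteDimensional.complete ℝ W
  have hc : ContDiffAt ℝ ω (expProd ι p) 0 := (contDiff_expProd ι p).contDiffAt
  have hω : (ω : WithTop ℕ∞) ≠ 0 := by simp
  -- The inverse function theorem at `0`: `ι ∘ p` projects `gl(W)` onto the Lie algebra with kernel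
  -- `ker p`, and `Φ` extends `exp` from the Lie algebra to a chart of `gl(W)`.
  set Φ := hc.toOpenPartialHomeomorph (expProd ι p) (hasFDerivAt_expProd ι p) hω
  have hΦc : ∀ A, Φ A = expProd ι p A := fun A => rfl
  have h0 : (0 : W →L[ℝ] W) ∈ Φ.source :=
    hc.mem_toOpenPartialHomeomorph_source (hasFDerivAt_expProd ι p) hω
  have hsymm : ContDiffAt ℝ ω Φ.symm (expProd ι p 0) :=
    hc.to_localInverse (hasFDerivAt_expProd ι p) hω
  have hK : Disjoint (lieSubmodule G) (LinearMap.ker (p : (W →L[ℝ] W) →ₗ[ℝ] L)) := by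
    rw [Submodule.disjoint_def]
    intro X hX hXp
    have h2 : p X = 0 := hXp
    rw [← hιp X hX, h2, map_zero]
  have hev1 : ∀ᶠ A in 𝓝 (0 : W →L[ℝ] W), expGL (A - ι (p A)) ∈ G → A - ι (p A) = 0 := by
    have hcont : Tendsto (fun A => A - ι (p A)) (𝓝 0) (𝓝 0) := by
      have h : Continuous fun A => A - ι (p A) := by fun_prop
      simpa using h.tendsto 0
    filter_upwards [hcont.eventually (eventually_eq_zero_of_expGL_mem G hK)] with A hA
    refine hA ?_
    change p (A - ι (p A)) = 0
    rw [map_sub, hp, sub_self]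
  have hev2 : ∀ᶠ A in 𝓝 (0 : W →L[ℝ] W), ContDiffAt ℝ ω Φ.symm (expProd ι p A) :=
    (contDiff_expProd ι p (n := 0)).continuous.continuousAt.eventually
      (hsymm.eventually (by simp))
  obtain ⟨D, hD, hDo, h0D⟩ := eventually_nhds_iff.1 (hev1.and hev2)
  set Ψ := Φ.restrOpen D hDo
  have hexp : ∀ X ∈ lieSubmodule G, expProd ι p X = NormedSpace.exp X := by
    intro X hX
    simp [expProd, hιp X hX, NormedSpace.exp_zero]
  -- If the product lies in `G`, so does its second factor, since the first one does. That factor is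
  -- the exponential of a small element of `ker p`, which must vanish: in the chart, `G` is exactly
  -- the Lie algebra.
  have hmem : ∀ A ∈ D, ∀ g : G.toSubgroup,
      expProd ι p A = ((g : (W →L[ℝ] W)ˣ) : W →L[ℝ] W) → ι (p A) = A := by
    intro A hA g hg
    refine (sub_eq_zero.1 ((hD A hA).1 ?_)).symm
    have h1 : expGL (ι (p A)) * expGL (A - ι (p A)) = (g : (W →L[ℝ] W)ˣ) := Units.ext hg
    rw [← eq_inv_mul_iff_mul_eq] at h1
    rw [h1]
    exact G.toSubgroup.mul_mem
      (G.toSubgroup.inv_mem (exp (⟨ι (p A), hι _⟩ : lieAlgebra G)).2) g.2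
  have hval : Continuous fun g : G.toSubgroup => ((g : (W →L[ℝ] W)ˣ) : W →L[ℝ] W) :=
    isEmbedding_val.continuous.comp continuous_subtype_val
  have hΨs : ∀ g : G.toSubgroup, ((g : (W →L[ℝ] W)ˣ) : W →L[ℝ] W) ∈ Ψ.target →
      Φ.symm ((g : (W →L[ℝ] W)ˣ) : W →L[ℝ] W) ∈ Ψ.source ∧
      ι (p (Φ.symm ((g : (W →L[ℝ] W)ˣ) : W →L[ℝ] W))) =
        Φ.symm ((g : (W →L[ℝ] W)ˣ) : W →L[ℝ] W) ∧
      expProd ι p (Φ.symm ((g : (W →L[ℝ] W)ˣ) : W →L[ℝ] W)) =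
        ((g : (W →L[ℝ] W)ˣ) : W →L[ℝ] W) := by
    intro g hg
    have h1 : Φ.symm ((g : (W →L[ℝ] W)ˣ) : W →L[ℝ] W) ∈ Ψ.source := Ψ.map_target hg
    have h2 : expProd ι p (Φ.symm ((g : (W →L[ℝ] W)ˣ) : W →L[ℝ] W)) = _ := Ψ.right_inv hg
    exact ⟨h1, hmem _ h1.2 g h2, h2⟩
  -- The target is the trace on `G` of an open subset of `gl(W)`, hence open in `G`; the same subset
  -- carries the smooth extension `p ∘ Φ.symm` of the logarithm.
  refine ⟨{ toFun := exp
            invFun := fun g => ⟨ι (p (Φ.symm ((g : (W →L[ℝ] W)ˣ) : W →L[ℝ] W))), hι _⟩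
            source := Subtype.val ⁻¹' Ψ.source
            target := (fun g : G.toSubgroup => ((g : (W →L[ℝ] W)ˣ) : W →L[ℝ] W)) ⁻¹' Ψ.target
            map_source' := ?_
            map_target' := ?_
            left_inv' := ?_
            right_inv' := ?_
            open_source := Ψ.open_source.preimage continuous_subtype_val
            open_target := Ψ.open_target.preimage hval
            continuousOn_toFun := ?_
            continuousOn_invFun := ?_ }, Ψ.target, fun w => p (Φ.symm w), ⟨h0, h0D⟩,
    fun X _ => rfl, Ψ.open_target, ?_, fun g hg => ⟨hg, rfl⟩⟩
  · intro X hX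
    have h := Ψ.map_source hX
    have h' : Ψ X = NormedSpace.exp (X : W →L[ℝ] W) := hexp X X.2
    rw [h'] at h
    exact h
  · intro g hg
    obtain ⟨h1, h2, -⟩ := hΨs g hg
    rw [← h2] at h1
    exact h1
  · intro X hX
    apply Subtype.ext
    change ι (p (Φ.symm (NormedSpace.exp (X : W →L[ℝ] W)))) = X
    rw [← hexp X X.2, ← hΦc, Φ.left_inv hX.1, hιp X X.2]
  · intro g hg
    obtain ⟨-, h2, h3⟩ := hΨs g hg
    apply Subtype.ext
    apply Units.ext
    change NormedSpace.exp (ι (p (Φ.symm ((g : (W →L[ℝ] W)ˣ) : W →L[ℝ] W)))) = _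
    rw [← hexp _ (hι _), h2, h3]
  · exact ((continuous_expGL.comp continuous_subtype_val).subtype_mk _).continuousOn
  · refine Topology.IsInducing.subtypeVal.continuousOn_iff.2 ?_
    exact (ι.comp p).continuous.comp_continuousOn
      (Ψ.continuousOn_symm.comp hval.continuousOn fun g hg => hg)
  · intro w hw
    have h1 : expProd ι p (Φ.symm w) = w := Ψ.right_inv hw
    have h2 := (hD (Φ.symm w) (Ψ.map_target hw).2).2
    rw [h1] at h2
    exact (p.contDiff.contDiffAt.comp w (h2.of_le le_top)).contDiffWithinAt

end ClosedSubgroup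

/-! ### The local homomorphism `exp X ↦ exp ρ(X)` -/

section LocalHomomorphism

variable {W : Type*} [NormedAddCommGroup W] [NormedSpace ℝ W]
variable {V : Type*} [NormedAddCommGroup V] [NormedSpace ℝ V]
variable {L : Type*} [NormedAddCommGroup L] [NormedSpace ℝ L]

/-- A linear map on the Lie algebra in linear coordinates. -/
noncomputable def coordMap [FiniteDimensional ℝ W] [FiniteDimensional ℝ L]
    {G : ClosedSubgroup (W →L[ℝ] W)ˣ}
    (ι : L →L[ℝ] (W →L[ℝ] W)) (hι : ∀ x, ι x ∈ lieSubmodule G)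
    (ρ : lieAlgebra G →ₗ⁅ℝ⁆ (V →L[ℝ] V)) : L →L[ℝ] (V →L[ℝ] V) :=
  LinearMap.toContinuousLinearMap
    { toFun := fun x => ρ ⟨ι x, hι x⟩
      map_add' := fun x y => by
        rw [← map_add]
        exact congrArg ρ (Subtype.ext (map_add ι x y))
      map_smul' := fun c x => by
        rw [RingHom.id_apply, ← map_smul]
        exact congrArg ρ (Subtype.ext (map_smul ι c x)) }

theorem contDiff_conjL_expGL [FiniteDimensional ℝ V] {n : WithTop ℕ∞} :
    ContDiff ℝ n fun A : V →L[ℝ] V => conjL (expGL A) := by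
  have : CompleteSpace V := FiniteDimensional.complete ℝ V
  exact contDiff_exp_conj

theorem SmoothOn.of_contDiffOn {E : Type*} [NormedAddCommGroup E] [NormedSpace ℝ E]
    {G : ClosedSubgroup (W →L[ℝ] W)ˣ} {U : Set G.toSubgroup} {f : G.toSubgroup → E}
    {O : Set (W →L[ℝ] W)} {F : (W →L[ℝ] W) → E} (hO : IsOpen O) (hF : ContDiffOn ℝ ∞ F O)
    (hUO : ∀ g ∈ U, ((g : (W →L[ℝ] W)ˣ) : W →L[ℝ] W) ∈ O)
    (hf : ∀ g ∈ U, F ((g : (W →L[ℝ] W)ˣ) : W →L[ℝ] W) = f g) : SmoothOn U f :=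
  fun g hg => ⟨O, F, hO, hUO g hg, hF, fun h hh _ => hf h hh⟩

/-- `exp` restricts to a local diffeomorphism from `𝔤` to `G` at `0`, and `exp X ↦ exp ρ(X)` is
smooth and multiplicative on its range. -/
theorem exists_local_hom [FiniteDimensional ℝ W] [FiniteDimensional ℝ V]
    (G : ClosedSubgroup (W →L[ℝ] W)ˣ)
    (ρ : lieAlgebra G →ₗ⁅ℝ⁆ (V →L[ℝ] V)) (N : Set (lieAlgebra G)) (hN : N ∈ 𝓝 0) :
    ∃ e : OpenPartialHomeomorph (lieAlgebra G) G.toSubgroup,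
      0 ∈ e.source ∧ e.source ⊆ N ∧ (∀ X ∈ e.source, e X = exp X) ∧
      SmoothOn e.target (fun g => (e.symm g : W →L[ℝ] W)) ∧
      SmoothOn e.target (fun g => (expGL (ρ (e.symm g)) : V →L[ℝ] V)) ∧
      SmoothOn e.target (fun g => conjL (expGL (ρ (e.symm g)))) ∧
      ∀ g ∈ e.target, ∀ h ∈ e.target, g * h ∈ e.target →
        expGL (ρ (e.symm (g * h))) = expGL (ρ (e.symm g)) * expGL (ρ (e.symm h)) := by
  have : CompleteSpace W := FiniteDimensional.complete ℝ W
  have : CompleteSpace V := FiniteDimensional.complete ℝ V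
  obtain ⟨n, ι, p, hp, hι, hιp⟩ := exists_coordinates G
  obtain ⟨e₀, O, F, h0, he₀, hO, hF, hFe⟩ := exists_openPartialHomeomorph_exp G ι p hp hι hιp
  set ψ := coordMap ι hι ρ
  have hψap : ∀ (x : Fin n → ℝ) (X : lieAlgebra G), ι x = X → ψ x = ρ X := fun x X h =>
    congrArg ρ (Subtype.ext h)
  have hcomm : ∀ x y, ι (coordBracket ι p x y) = ι x * ι y - ι y * ι x := fun x y =>
    hιp _ (commutator_mem G (hι x) (hι y))
  have hψ : ∀ x y, ψ (coordBracket ι p x y) = ψ x * ψ y - ψ y * ψ x := by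
    intro x y
    have h := LieHom.map_lie ρ (⟨ι x, hι x⟩ : lieAlgebra G) ⟨ι y, hι y⟩
    rw [Ring.lie_def] at h
    exact (hψap _ ⁅(⟨ι x, hι x⟩ : lieAlgebra G), ⟨ι y, hι y⟩⁆ (hcomm x y)).trans h
  have hinj : Function.Injective ι := Function.LeftInverse.injective hp
  set E : (Fin n → ℝ) → G.toSubgroup := fun x => exp (⟨ι x, hι x⟩ : lieAlgebra G)
  have hEc : Continuous E :=
    (continuous_expGL.comp ι.continuous).subtype_mk _
  have hE0 : E 0 = 1 := by
    apply Subtype.ext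
    change expGL (ι 0) = 1
    rw [map_zero, expGL_zero]
  have h1t : (1 : G.toSubgroup) ∈ e₀.target := by
    have h := e₀.map_source h0
    rw [he₀ 0 h0] at h
    convert! h using 1
    apply Subtype.ext
    exact expGL_zero.symm
  -- Products from this ball stay in the larger set `e₀.target`, where the logarithm exists. As the
  -- ball contains `t • y` along with `y`, the whole path `exp x * exp (t y)` with `0 ≤ t ≤ 1` stays
  -- there.
  obtain ⟨r, hr, hball⟩ : ∃ r > 0, ∀ x ∈ Metric.ball (0 : Fin n → ℝ) r,
      ∀ y ∈ Metric.ball (0 : Fin n → ℝ) r, E x * E y ∈ e₀.target := by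
    have hc : Continuous fun z : (Fin n → ℝ) × (Fin n → ℝ) => E z.1 * E z.2 :=
      (hEc.comp continuous_fst).mul (hEc.comp continuous_snd)
    have hn : (fun z : (Fin n → ℝ) × (Fin n → ℝ) => E z.1 * E z.2) ⁻¹' e₀.target ∈ 𝓝 (0, 0) := by
      refine hc.continuousAt.preimage_mem_nhds (e₀.open_target.mem_nhds ?_)
      simpa [hE0] using h1t
    obtain ⟨r, hr, h⟩ := Metric.mem_nhds_iff.1 hn
    rw [← ball_prod_same] at h
    exact ⟨r, hr, fun x hx y hy => h (Set.mk_mem_prod hx hy)⟩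
  have hpc : Continuous fun X : lieAlgebra G => p (X : W →L[ℝ] W) :=
    p.continuous.comp continuous_subtype_val
  set D : Set (lieAlgebra G) := interior N ∩
    (fun X : lieAlgebra G => p (X : W →L[ℝ] W)) ⁻¹' Metric.ball 0 r
  have hDo : IsOpen D := isOpen_interior.inter (Metric.isOpen_ball.preimage hpc)
  set e := e₀.restrOpen D hDo
  have hEp : ∀ X : lieAlgebra G, E (p (X : W →L[ℝ] W)) = exp X := fun X =>
    congrArg exp (Subtype.ext (hιp X X.2))
  have htarget : ∀ g ∈ e.target, g ∈ e₀.target := fun g hg => hg.1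
  have hO' : ∀ g ∈ e.target, ((g : (W →L[ℝ] W)ˣ) : W →L[ℝ] W) ∈ O := fun g hg =>
    (hFe g (htarget g hg)).1
  have hψF : ∀ g ∈ e₀.target, ψ (F ((g : (W →L[ℝ] W)ˣ) : W →L[ℝ] W)) = ρ (e₀.symm g) :=
    fun g hg => hψap _ _ (hFe g hg).2
  have hψFs : ContDiffOn ℝ ∞ (fun w => ψ (F w)) O := ψ.contDiff.comp_contDiffOn hF
  have hlog : ∀ g ∈ e₀.target, exp (e₀.symm g) = g := fun g hg => by
    rw [← he₀ _ (e₀.map_target hg), e₀.right_inv hg]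
  refine ⟨e, ⟨h0, mem_interior_iff_mem_nhds.2 hN, ?_⟩, fun X hX => interior_subset hX.2.1,
    fun X hX => he₀ X hX.1,
    .of_contDiffOn hO (ι.contDiff.comp_contDiffOn hF) hO' fun g hg => (hFe g (htarget g hg)).2,
    .of_contDiffOn hO (contDiff_exp.comp_contDiffOn hψFs) hO' fun g hg =>
      congrArg NormedSpace.exp (hψF g (htarget g hg)),
    .of_contDiffOn hO (contDiff_conjL_expGL.comp_contDiffOn hψFs) hO' fun g hg =>
      congrArg (fun A => conjL (expGL A)) (hψF g (htarget g hg)), ?_⟩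
  · have hp0 : p ((0 : lieAlgebra G) : W →L[ℝ] W) = 0 := map_zero p
    rw [Set.mem_preimage, hp0]
    exact Metric.mem_ball_self hr
  intro g hg h hh hgh
  set x := p (e.symm g : W →L[ℝ] W)
  set y := p (e.symm h : W →L[ℝ] W)
  have hgD : x ∈ Metric.ball 0 r := (e.map_target hg).2.2
  have hhD : y ∈ Metric.ball 0 r := (e.map_target hh).2.2
  have hEx : E x = g := (hEp _).trans (hlog g (htarget g hg))
  have hEy : E y = h := (hEp _).trans (hlog h (htarget h hh))
  set γ : ℝ → (W →L[ℝ] W) := fun t => NormedSpace.exp (ι x) * NormedSpace.exp (t • ι y) with hγ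
  have hEγ : ∀ t, (((E x * E (t • y) : G.toSubgroup) : (W →L[ℝ] W)ˣ) : W →L[ℝ] W) = γ t := by
    intro t
    change NormedSpace.exp (ι x) * NormedSpace.exp (ι (t • y)) = _
    rw [map_smul]
  have hmem : ∀ t ∈ Set.Icc (0 : ℝ) 1, E x * E (t • y) ∈ e₀.target := by
    intro t ht
    refine hball x hgD _ ?_
    rw [mem_ball_zero_iff] at hhD ⊢
    rw [norm_smul, Real.norm_of_nonneg ht.1]
    exact (mul_le_of_le_one_left (norm_nonneg _) ht.2).trans_lt hhD
  have hγd : Differentiable ℝ γ := fun t =>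
    ((hasDerivAt_exp_smul_const (𝕂 := ℝ) (ι y) t).const_mul _).differentiableAt
  have hιF : ∀ t, E x * E (t • y) ∈ e₀.target → NormedSpace.exp (ι (F (γ t))) = γ t := by
    intro t ht
    have h2 := congrArg (fun g : G.toSubgroup => ((g : (W →L[ℝ] W)ˣ) : W →L[ℝ] W)) (hlog _ ht)
    rw [← hEγ t, (hFe _ ht).2]
    exact h2
  have hEx0 : E x * E ((0 : ℝ) • y) = g := by rw [zero_smul, hE0, mul_one, hEx]
  have hEx1 : E x * E ((1 : ℝ) • y) = g * h := by rw [one_smul, hEx, hEy]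
  -- `Z t = F (γ t)` is the logarithm of `exp x * exp (t y)` in coordinates, with `Z 0 = log g` and
  -- `Z 1 = log (g h)`. The faithful representation is `ι`, the other one is `ψ`, that is, `ρ`.
  have key := exp_map_eq_of_hasDerivAt (coordBracket ι p) ι ψ hcomm hψ hinj
    (Z := fun t => F (γ t)) (y := y) ?_ ?_
  · apply Units.ext
    simp only [← hEγ, hEx0, hEx1] at key
    rw [hψF _ (htarget _ hgh), hψF _ (htarget _ hg), hψap y (e.symm h) (hιp _ (e.symm h).2)] at key
    exact key
  · intro t ht
    have hd : DifferentiableAt ℝ F (γ t) := by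
      rw [← hEγ]
      exact (hF.contDiffAt (hO.mem_nhds (hFe _ (hmem t ht)).1)).differentiableAt (by simp)
    exact hd.comp t (hγd t)
  · intro t ht
    have hc : Continuous fun t : ℝ => E x * E (t • y) :=
      continuous_const.mul (hEc.comp (continuous_id.smul continuous_const))
    have h0' : NormedSpace.exp (ι (F (γ 0))) = NormedSpace.exp (ι x) := by
      rw [hιF 0 (hmem 0 (by simp)), hγ]
      simp [NormedSpace.exp_zero]
    -- The path stays in the open set `e₀.target` for `s` near `t`, even beyond the endpoints of
    -- `[0, 1]`, which gives two-sided derivatives there.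
    filter_upwards [hc.continuousAt.preimage_mem_nhds (e₀.open_target.mem_nhds (hmem t ht))]
      with s hs
    rw [hιF s hs, h0']

end LocalHomomorphism

end LinearLie

/-! ### Passage to the adjoint representation -/

theorem claim6p2p1
    {W : Type*} [NormedAddCommGroup W] [NormedSpace ℝ W] [FiniteDimensional ℝ W]
    {V : Type*} [NormedAddCommGroup V] [NormedSpace ℝ V] [FiniteDimensional ℝ V]
    (G : ClosedSubgroup (W →L[ℝ] W)ˣ)
    (ρ : LinearLie.lieAlgebra G →ₗ⁅ℝ⁆ (V →L[ℝ] V))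
    (N : Set (LinearLie.lieAlgebra G)) (hN : N ∈ 𝓝 0) :
    ∃ e : OpenPartialHomeomorph (LinearLie.lieAlgebra G) G.toSubgroup,
      -- `e` is `exp : 𝒱 → 𝒰`, with smooth inverse, on a neighbourhood `𝒱 ⊆ N` of `0`
      0 ∈ e.source ∧ e.source ⊆ N ∧ (∀ X ∈ e.source, e X = LinearLie.exp X) ∧
      LinearLie.SmoothOn e.target (fun g => (e.symm g : W →L[ℝ] W)) ∧
      -- `exp X ↦ Ad_{exp ρ(X)}`, with values in `Gl(gl(V))`
      (∃ R : G.toSubgroup → ((V →L[ℝ] V) →L[ℝ] (V →L[ℝ] V))ˣ,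
        (∀ X ∈ e.source, R (LinearLie.exp X) = LinearLie.Ad (LinearLie.expGL (ρ X))) ∧
        LinearLie.IsLocalLieGroupHom e.target R) ∧
      -- `exp X ↦ exp ρ(X)`, with values in `Gl(V)`
      (∃ S : G.toSubgroup → (V →L[ℝ] V)ˣ,
        (∀ X ∈ e.source, S (LinearLie.exp X) = LinearLie.expGL (ρ X)) ∧
        LinearLie.IsLocalLieGroupHom e.target S) := by
  obtain ⟨e, h0, heN, hexp, hlog, hS, hR, hmul⟩ := LinearLie.exists_local_hom G ρ N hN
  have h1 : (1 : G.toSubgroup) ∈ e.target := by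
    have h := e.map_source h0
    rw [hexp 0 h0] at h
    convert! h using 1
    exact (Subtype.ext LinearLie.expGL_zero).symm
  have hsymm : ∀ X ∈ e.source, e.symm (LinearLie.exp X) = X := fun X hX => by
    rw [← hexp X hX, e.left_inv hX]
  -- `R` and `S` are defined on all of `G` through `e.symm`; their values outside `e.target` play no
  -- role.
  refine ⟨e, h0, heN, hexp, hlog,
    ⟨fun g => LinearLie.Ad (LinearLie.expGL (ρ (e.symm g))), fun X hX => ?_,
      ⟨e.open_target, h1, hR, fun g hg h hh hgh => ?_⟩⟩,
    ⟨fun g => LinearLie.expGL (ρ (e.symm g)), fun X hX => ?_, ⟨e.open_target, h1, hS, hmul⟩⟩⟩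
  · simp only [hsymm X hX]
  · apply Units.ext
    simp only [hmul g hg h hh hgh]
    exact (LinearLie.conjL_mul _ _).symm
  · simp only [hsymm X hX]
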